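/- Let $m\ge 0$ be an integer and let $\mathfrak I^{(m)}$ be the set of all involutions $\tau$ (permutations of $\{1,\dots,n\}$ with $\tau=\tau^{-1}$, for any $n=|\tau|\ge 0$) that avoid the pattern $(m+1)m\cdots 21$, that is, for which there are no positions $p_1<\cdots<p_{m+1}$ with $\tau(p_1)>\cdots>\tau(p_{m+1})$. For $i\in\mathbb Z$ define the formal power series $$I_i=\sum_{n\ge \max(0,-i)}\frac{t^{2n+i}}{n!\,(n+i)!}\in\mathbb Q[[t]].$$ Then, as formal power series in $t$, $$\sum_{\tau\in\mathfrak I^{(m)}}\frac{t^{|\tau|}}{|\tau|!}=\begin{cases} e^t\,\det\left(I_{i-j}-I_{i+j}\right)_{1\le i,j\le \ell}, & \text{if } m=2\ell+1,\\ \det\left(I_{i-j}+I_{i+j-1}\right)_{1\le i,j\le \ell}, & \text{if } m=2\ell,\end{cases}$$ where the empty determinant ($\ell=0$) equals $1$. -/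

import Mathlib

open scoped Nat

/-- `τ`, a permutation of `n` letters, has a descending subsequence of length `k`, that is, an
occurrence of the pattern `k ⋯ 2 1`: there are positions `p 0 < ⋯ < p (k - 1)` at which
the values of `τ` decrease strictly. -/
def HasDescendingSubsequence {n : ℕ} (τ : Equiv.Perm (Fin n)) (k : ℕ) : Prop :=
  ∃ p : Fin k → Fin n, StrictMono p ∧ StrictAnti fun a => τ (p a)

/-- The involutions (permutations equal to their inverse) of length `n` avoiding the pattern
`(m + 1) m ⋯ 2 1`. -/
def avoidingInvolutions (m n : ℕ) : Set (Equiv.Perm (Fin n)) :=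
  {τ | Function.Involutive τ ∧ ¬ HasDescendingSubsequence τ (m + 1)}

/-- The exponential generating function `∑ t ^ |τ| / |τ|!`, over the involutions `τ` of any length
avoiding `(m + 1) m ⋯ 2 1`, as a formal power series in `t`. -/
noncomputable def involutionEGF (m : ℕ) : PowerSeries ℚ :=
  PowerSeries.mk fun n => ((avoidingInvolutions m n).ncard : ℚ) / (n ! : ℚ)

/-- The formal power series `∑ t ^ (2 n + i) / (n! (n + i)!)`, over the `n ≥ max 0 (-i)`, for an
integer `i`. The coefficient of `t ^ k` collects the `n` with `2 n + i = k`; since `n + i ≥ 0`,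
these satisfy `n ≤ k`. -/
noncomputable def besselSeries (i : ℤ) : PowerSeries ℚ :=
  PowerSeries.mk fun k =>
    ∑ n ∈ (Finset.range (k + 1)).filter
        (fun n : ℕ => max 0 (-i) ≤ (n : ℤ) ∧ 2 * (n : ℤ) + i = (k : ℤ)),
      (1 : ℚ) / ((n ! : ℚ) * ((((n : ℤ) + i).toNat) ! : ℚ))

/-!
The proof passes through walks on Young's lattice, in three steps.

*Nestings.* In an involution `τ`, a descending sequence of positions consists of excedances
(`p < τ p`), then at most one fixed point, then positions with `τ p < p`; conversely a set `s` of
excedances on which `τ` is decreasing (a nesting of arcs) yields the descending sequence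
`s ∪ τ '' s`. So `τ` avoids `(2 ℓ + 2) ⋯ 1` iff no nesting has more than `ℓ` arcs, and it avoids
`(2 ℓ + 1) ⋯ 1` iff the same holds for nestings in which the innermost arc may be a fixed point
(`forall_isNesting_iff`). The Boolean `w` (weak excedances allowed) tells the two cases apart: it is
`true` for `m = 2 ℓ` and `false` for `m = 2 ℓ + 1`.

*From involutions to walks.* Read the positions from the last to the first, and keep a tableau of
the left ends of the arcs whose right end has been read: on meeting the right end of an arc,
row-insert its left end; on meeting a left end, which is the largest entry of the tableau, delete it.
By Schensted, the length of the first row is the largest size of a nesting around the current gap, so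
the avoidance condition becomes "at most `ℓ` columns" (and, in the weak case, "fewer than `ℓ`
columns at a fixed point"). Only the set of positions in the tableau and its first row matter for
this condition (`completionCount_eq_ncard`). That row insertion is a bijection between pairs
(tableau, new entry) and pairs (tableau, removable cell) is `tableauSum_insertions`; it gives a
recurrence, `tableauWeight_succ`, which says that the involutions are counted by closed walks on the
partitions with at most `ℓ` columns, whose steps add a cell, remove a cell, or stay.

*Reflection.* Encode a partition by the strictly decreasing positive integers
`x j = ℓ - j + (length of column j)`. The series `besselSeries` satisfies
`d/dt I i = I (i - 1) + I (i + 1)`, hence the determinant with columns `I (x j - y) ∓ ⋯` has as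
derivative the sum of its values at the neighbours of `x`; for `w = false`, the factor `exp` adds
its value at `x` itself. It vanishes when two coordinates collide, and at the wall `x j = 0` it
vanishes (`w = false`) or agrees with its value at `x j = 1` (`w = true`). The factor `exp`,
respectively the wall, produces the staying steps. Thus its coefficients satisfy the recurrence of the walks (`tableauWeight_eq_coeff`), and the empty partition gives the theorem.
-/

/-! ### Shapes, tableaux and row insertion -/

/-- The rows of a partition `μ` (row lengths, numbered from `0`) whose last cell can be removed. -/
def removableRows (μ : ℕ →₀ ℕ) : Finset ℕ := μ.support.filter fun k => μ (k + 1) < μ k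

/-- The rows of a partition `μ` to which a cell can be added: row `0`, and the row below each
removable cell. -/
def addableRows (μ : ℕ →₀ ℕ) : Finset ℕ := insert 0 ((removableRows μ).image (· + 1))

theorem mem_removableRows {μ : ℕ →₀ ℕ} {k : ℕ} : k ∈ removableRows μ ↔ μ (k + 1) < μ k := by
  simp only [removableRows, Finset.mem_filter, Finsupp.mem_support_iff, and_iff_right_iff_imp]
  omega

theorem mem_addableRows {μ : ℕ →₀ ℕ} {a : ℕ} :
    a ∈ addableRows μ ↔ a = 0 ∨ μ a < μ (a - 1) := by
  rcases a with _ | a <;> simp [addableRows, mem_removableRows]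

theorem sum_addableRows {M : Type*} [AddCommMonoid M] (μ : ℕ →₀ ℕ) (f : ℕ → M) :
    ∑ a ∈ addableRows μ, f a = f 0 + ∑ k ∈ removableRows μ, f (k + 1) := by
  rw [addableRows, Finset.sum_insert (by simp), Finset.sum_image (by simp)]

/-- The shape `μ` with a cell added to row `a`. -/
noncomputable def addCell (μ : ℕ →₀ ℕ) (a : ℕ) : ℕ →₀ ℕ := μ + Finsupp.single a 1

/-- The shape `μ` with a cell of row `k` removed. -/
noncomputable def removeCell (μ : ℕ →₀ ℕ) (k : ℕ) : ℕ →₀ ℕ := μ - Finsupp.single k 1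

theorem mem_addableRows_iff {μ : ℕ →₀ ℕ} (hμ : Antitone μ) {a : ℕ} :
    a ∈ addableRows μ ↔ ∀ i < a, μ a < μ i := by
  rw [mem_addableRows]
  rcases a with _ | a
  · simp
  · refine ⟨fun h i hi => ?_, fun h => Or.inr (h _ (by omega))⟩
    have := hμ (show i ≤ a by omega)
    simp at h
    omega

theorem addCell_apply (μ : ℕ →₀ ℕ) (a i : ℕ) :
    (addCell μ a) i = μ i + if i = a then 1 else 0 := by
  simp [addCell, Finsupp.single_apply, eq_comm]

theorem removeCell_apply (μ : ℕ →₀ ℕ) (k i : ℕ) :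
    (removeCell μ k) i = μ i - if i = k then 1 else 0 := by
  simp [removeCell, Finsupp.single_apply, eq_comm]

theorem antitone_addCell {μ : ℕ →₀ ℕ} (hμ : Antitone μ) {a : ℕ} (ha : a ∈ addableRows μ) :
    Antitone (addCell μ a) := by
  refine antitone_nat_of_succ_le fun i => ?_
  rw [mem_addableRows_iff hμ] at ha
  have h1 := ha i
  have h2 := hμ (show i ≤ i + 1 by omega)
  rw [addCell_apply, addCell_apply]
  by_cases h3 : i + 1 = a
  · subst h3; simp at h1 ⊢; omega
  · simp only [h3, if_false]; omega

theorem antitone_removeCell {μ : ℕ →₀ ℕ} (hμ : Antitone μ) {k : ℕ} (hk : k ∈ removableRows μ) :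
    Antitone (removeCell μ k) := by
  refine antitone_nat_of_succ_le fun i => ?_
  rw [mem_removableRows] at hk
  have h2 := hμ (show i ≤ i + 1 by omega)
  rw [removeCell_apply, removeCell_apply]
  by_cases h3 : i = k
  · subst h3; simp; omega
  · simp only [h3, if_false]; omega

theorem mem_addableRows_removeCell {μ : ℕ →₀ ℕ} (hμ : Antitone μ) {k : ℕ}
    (hk : k ∈ removableRows μ) : k ∈ addableRows (removeCell μ k) := by
  rw [mem_addableRows_iff (antitone_removeCell hμ hk)]
  intro i hi
  have := hμ hi.le
  rw [mem_removableRows] at hk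
  rw [removeCell_apply, removeCell_apply, if_pos rfl, if_neg (by omega)]
  omega

theorem mem_removableRows_addCell {μ : ℕ →₀ ℕ} (hμ : Antitone μ) (a : ℕ) :
    a ∈ removableRows (addCell μ a) := by
  have := hμ (show a ≤ a + 1 by omega)
  rw [mem_removableRows, addCell_apply, addCell_apply, if_pos rfl, if_neg (by omega)]
  omega

theorem addCell_removeCell {μ : ℕ →₀ ℕ} {k : ℕ} (hk : k ∈ removableRows μ) :
    addCell (removeCell μ k) k = μ := by
  rw [mem_removableRows] at hk
  exact tsub_add_cancel_of_le (by simp; omega)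

theorem removeCell_addCell (μ : ℕ →₀ ℕ) (a : ℕ) : removeCell (addCell μ a) a = μ :=
  add_tsub_cancel_right _ _

/-- The sum of `F T` over the tableaux `T` of shape `μ` with distinct entries among the positions
`0, …, n - 1`, increasing along rows and columns. A tableau is encoded by the list of length `n`
that records, from position `n - 1` down to position `0`, the letter `0` if the position is not an
entry and the letter `k + 1` if it is an entry of row `k`. -/
noncomputable def tableauSum : ℕ → (ℕ →₀ ℕ) → (List ℕ → ℕ) → ℕ
  | 0, μ, F => if μ = 0 then F [] else 0
  | n + 1, μ, F => tableauSum n μ (fun T => F (0 :: T)) +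
      ∑ k ∈ removableRows μ, tableauSum n (removeCell μ k) fun T => F ((k + 1) :: T)

/-- The results of row-inserting into `T` each position that is not an entry of `T`, together with
the row in which the shape grows. An insertion is carried out while reading positions upwards: if
the shape of the part read so far has grown in row `k`, then the next entry of row `k` is bumped to
row `k + 1`, and from there on it is row `k + 1` that has grown. -/
def insertions : List ℕ → List (List ℕ × ℕ)
  | [] => []
  | 0 :: T => (1 :: T, 0) :: (insertions T).map fun p => (0 :: p.1, p.2)
  | (k + 1) :: T => (insertions T).map fun p =>
      if p.2 = k then ((k + 2) :: p.1, k + 1) else ((k + 1) :: p.1, p.2)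

theorem tableauSum_add (n : ℕ) : ∀ (μ : ℕ →₀ ℕ) (F G : List ℕ → ℕ),
    tableauSum n μ (fun T => F T + G T) = tableauSum n μ F + tableauSum n μ G := by
  induction n with
  | zero => intro μ F G; simp only [tableauSum]; split_ifs <;> rfl
  | succ n ih =>
    intro μ F G
    simp only [tableauSum, ih, Finset.sum_add_distrib]
    ring

theorem tableauSum_const_mul (n : ℕ) : ∀ (μ : ℕ →₀ ℕ) (c : ℕ) (F : List ℕ → ℕ),
    tableauSum n μ (fun T => c * F T) = c * tableauSum n μ F := by
  induction n with
  | zero => intro μ c F; simp only [tableauSum]; split_ifs <;> simp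
  | succ n ih =>
    intro μ c F
    simp only [tableauSum, ih, mul_add, Finset.mul_sum]

theorem tableauSum_congr (n : ℕ) : ∀ {μ : ℕ →₀ ℕ} {F G : List ℕ → ℕ},
    (∀ T : List ℕ, T.length = n → (∀ k, T.count (k + 1) = μ k) → F T = G T) →
    tableauSum n μ F = tableauSum n μ G := by
  induction n with
  | zero =>
    intro μ F G h
    simp only [tableauSum]
    split_ifs with h0
    · exact h [] rfl (by simp [h0])
    · rfl
  | succ n ih =>
    intro μ F G h
    simp only [tableauSum]
    congr 1
    · exact ih fun T hT hc => h _ (by simp [hT]) (by simpa using hc)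
    · refine Finset.sum_congr rfl fun k hk => ih fun T hT hc => h _ (by simp [hT]) fun i => ?_
      rw [mem_removableRows] at hk
      rw [List.count_cons, hc, removeCell_apply]
      by_cases hik : k = i
      · subst hik; simp; omega
      · simp [hik, Ne.symm hik]

/-- Row insertion is a bijection: a tableau of shape `μ` with a non-entry corresponds to an addable
row `a` with a tableau of shape `addCell μ a`. By induction on the number of positions; the bumps at
the last position match row `k` of the removable cells with row `k + 1` of the addable ones, and the
insertions of the last position account for the addable row `0`. -/
theorem tableauSum_insertions (n : ℕ) : ∀ {μ : ℕ →₀ ℕ} (_ : Antitone μ) (F : List ℕ → ℕ → ℕ),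
    tableauSum n μ (fun T => ((insertions T).map fun p => F p.1 p.2).sum) =
      ∑ a ∈ addableRows μ, tableauSum n (addCell μ a) fun T => F T a := by
  induction n with
  | zero =>
    intro μ _ F
    simp only [tableauSum, insertions, List.map_nil, List.sum_nil, ite_self]
    refine (Finset.sum_eq_zero fun a _ => if_neg fun h => ?_).symm
    simpa [addCell] using DFunLike.congr_fun h a
  | succ n ih =>
    intro μ hμ F
    have hF : ∀ k T, ((insertions ((k + 1) :: T)).map fun p => F p.1 p.2).sum =
        ((insertions T).map fun p => if p.2 = k then F ((k + 2) :: p.1) (k + 1)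
          else F ((k + 1) :: p.1) p.2).sum := by
      intro k T
      simp only [insertions, List.map_map]
      congr 2
      funext p
      simp only [Function.comp]
      split_ifs <;> rfl
    have h0 : ∀ T, ((insertions (0 :: T)).map fun p => F p.1 p.2).sum =
        F (1 :: T) 0 + ((insertions T).map fun p => F (0 :: p.1) p.2).sum := by
      intro T
      simp only [insertions, List.map_cons, List.map_map, List.sum_cons]
      rfl
    have e0 : (tableauSum n μ fun T => ((insertions T).map fun p => F (0 :: p.1) p.2).sum) = _ :=
      ih hμ fun T a => F (0 :: T) a
    have e1 : ∀ k ∈ removableRows μ, (tableauSum n (removeCell μ k) fun T =>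
        ((insertions ((k + 1) :: T)).map fun p => F p.1 p.2).sum) =
        ∑ a ∈ addableRows (removeCell μ k),
          tableauSum n (addCell (removeCell μ k) a) fun T =>
            if a = k then F ((k + 2) :: T) (k + 1) else F ((k + 1) :: T) a := by
      intro k hk
      simp only [hF]
      exact ih (antitone_removeCell hμ hk) fun T a =>
        if a = k then F ((k + 2) :: T) (k + 1) else F ((k + 1) :: T) a
    simp only [tableauSum, Finset.sum_add_distrib]
    rw [Finset.sum_congr rfl e1]
    simp only [h0, tableauSum_add, e0]
    -- on both sides, the terms in which the cell added is the cell removed are split off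
    have hL : ∀ k ∈ removableRows μ,
        (∑ a ∈ addableRows (removeCell μ k),
          tableauSum n (addCell (removeCell μ k) a) fun T =>
            if a = k then F ((k + 2) :: T) (k + 1) else F ((k + 1) :: T) a) =
        tableauSum n μ (fun T => F ((k + 2) :: T) (k + 1)) +
        ∑ a ∈ (addableRows (removeCell μ k)).erase k,
          tableauSum n (addCell (removeCell μ k) a) fun T =>
            F ((k + 1) :: T) a := by
      intro k hk
      rw [← Finset.add_sum_erase _ _ (mem_addableRows_removeCell hμ hk)]
      congr 1
      · rw [addCell_removeCell hk]
        simp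
      · refine Finset.sum_congr rfl fun a ha => ?_
        simp [(Finset.mem_erase.1 ha).1]
    have hR : ∀ a ∈ addableRows μ,
        (∑ k ∈ removableRows (addCell μ a),
          tableauSum n (removeCell (addCell μ a) k) fun T =>
            F ((k + 1) :: T) a) =
        tableauSum n μ (fun T => F ((a + 1) :: T) a) +
        ∑ k ∈ (removableRows (addCell μ a)).erase a,
          tableauSum n (removeCell (addCell μ a) k) fun T =>
            F ((k + 1) :: T) a := by
      intro a ha
      rw [← Finset.add_sum_erase _ _ (mem_removableRows_addCell hμ a), removeCell_addCell]
    rw [Finset.sum_congr rfl hL, Finset.sum_congr rfl hR, Finset.sum_add_distrib,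
      Finset.sum_add_distrib, sum_addableRows μ fun a => tableauSum n μ fun T => F ((a + 1) :: T) a]
    have hcomm : (∑ k ∈ removableRows μ, ∑ a ∈ (addableRows (removeCell μ k)).erase k,
          tableauSum n (addCell (removeCell μ k) a) fun T =>
            F ((k + 1) :: T) a) =
        ∑ a ∈ addableRows μ, ∑ k ∈ (removableRows (addCell μ a)).erase a,
          tableauSum n (removeCell (addCell μ a) k) fun T =>
            F ((k + 1) :: T) a := by
      rw [Finset.sum_comm' (t' := addableRows μ)
        (s' := fun a => (removableRows (addCell μ a)).erase a)]
      · refine Finset.sum_congr rfl fun a _ => Finset.sum_congr rfl fun k hk => ?_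
        have hka := (Finset.mem_erase.1 hk).1
        congr 1
        ext i
        simp only [addCell_apply, removeCell_apply]
        split_ifs <;> omega
      · intro k a
        simp only [mem_removableRows, Finset.mem_erase, mem_addableRows, addCell_apply,
          removeCell_apply]
        rcases eq_or_ne a k with h | h
        · simp [h]
        rcases a with _ | a
        · simp [h, h.symm]
        rcases eq_or_ne a k with h' | h'
        · subst h'; simp; omega
        · simp [h, h', h.symm, Ne.symm h', and_comm]
    rw [hcomm]
    ring

/-- The number of ways to match the positions `0, …, n - 1` that are not entries of `T` by an
involution, subject to the bound `ℓ`: a fixed point leaves `T` alone (and needs fewer than `ℓ`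
columns if `w`), a right end of an arc has its left end inserted into `T`, and an entry of `T`, the
left end of an arc whose right end was read before, is removed. All tableaux met must have a first
row, the letters `1`, of length at most `ℓ`. The interpretation is proved in
`completionCount_eq_ncard`. -/
def completionCount (w : Bool) (ℓ : ℕ) : ℕ → List ℕ → ℕ
  | 0, _ => 1
  | _ + 1, [] => 0
  | n + 1, 0 :: T =>
    if T.count 1 ≤ ℓ then
      (if w = true → T.count 1 < ℓ then completionCount w ℓ n T else 0) +
        ((insertions T).map fun p => completionCount w ℓ n p.1).sum
    else 0
  | n + 1, (k + 1) :: T => if ((k + 1) :: T).count 1 ≤ ℓ then completionCount w ℓ n T else 0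

/-- The total of `completionCount` over the tableaux of shape `μ`; it is also the number of walks of
length `n` from the empty partition to `μ` described by `tableauWeight_succ`. -/
noncomputable def tableauWeight (w : Bool) (ℓ n : ℕ) (μ : ℕ →₀ ℕ) : ℕ :=
  tableauSum n μ (completionCount w ℓ n)

theorem tableauSum_eq_zero (n : ℕ) {μ : ℕ →₀ ℕ} {F : List ℕ → ℕ}
    (h : ∀ T : List ℕ, T.length = n → (∀ k, T.count (k + 1) = μ k) → F T = 0) :
    tableauSum n μ F = 0 := by
  rw [tableauSum_congr n h]
  simpa using tableauSum_const_mul n μ 0 fun _ => 0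

theorem tableauWeight_zero (w : Bool) (ℓ : ℕ) (μ : ℕ →₀ ℕ) :
    tableauWeight w ℓ 0 μ = if μ = 0 then 1 else 0 := rfl

theorem tableauWeight_eq_zero (w : Bool) {ℓ : ℕ} (n : ℕ) {μ : ℕ →₀ ℕ} (h : ℓ < μ 0) :
    tableauWeight w ℓ n μ = 0 := by
  rcases n with _ | n
  · rw [tableauWeight_zero, if_neg]
    rintro rfl
    simp at h
  refine tableauSum_eq_zero _ fun T hT hc => ?_
  have h0 := hc 0
  rcases T with _ | ⟨k, T⟩
  · simp at hT
  rcases k with _ | k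
  · rw [completionCount, if_neg]
    simp at h0; omega
  · rw [completionCount, if_neg]
    rw [h0]; omega

theorem tableauWeight_succ (w : Bool) {ℓ : ℕ} (n : ℕ) {μ : ℕ →₀ ℕ} (hμ : Antitone μ)
    (h : μ 0 ≤ ℓ) :
    tableauWeight w ℓ (n + 1) μ = (if w = true → μ 0 < ℓ then tableauWeight w ℓ n μ else 0) +
      ∑ a ∈ addableRows μ, tableauWeight w ℓ n (addCell μ a) +
      ∑ k ∈ removableRows μ, tableauWeight w ℓ n (removeCell μ k) := by
  unfold tableauWeight
  rw [← tableauSum_insertions n hμ fun T _ => completionCount w ℓ n T, tableauSum]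
  congr 1
  · have e : (if w = true → μ 0 < ℓ then tableauSum n μ (completionCount w ℓ n) else 0) =
        tableauSum n μ fun T =>
          (if w = true → μ 0 < ℓ then 1 else 0) * completionCount w ℓ n T := by
      rw [tableauSum_const_mul]; split_ifs <;> simp
    rw [e, ← tableauSum_add]
    refine tableauSum_congr n fun T _ hc => ?_
    have h0 := hc 0
    rw [completionCount, h0, if_pos h]
    simp
  · refine Finset.sum_congr rfl fun k hk => tableauSum_congr n fun T _ hc => ?_
    have h0 := hc 0
    rw [mem_removableRows] at hk
    rw [removeCell_apply] at h0
    rw [completionCount, if_pos]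
    rw [List.count_cons]
    simp at h0 ⊢
    rw [h0]
    by_cases hk0 : k = 0
    · subst hk0; simp; omega
    · simp [hk0, Ne.symm hk0]; omega

/-- The positions that are not entries of the tableau. -/
def vacant : List ℕ → Finset ℕ
  | [] => ∅
  | 0 :: T => insert T.length (vacant T)
  | (_ + 1) :: T => vacant T

/-- The number of entries in the first row of the tableau that are smaller than `x`. -/
def firstRow : List ℕ → ℕ → ℕ
  | [], _ => 0
  | k :: T, x => firstRow T x + if k = 1 ∧ T.length < x then 1 else 0

/-- The effect on `firstRow` of inserting `j`: an entry `j` appears in the first row, and the next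
entry after it, if there is one, is bumped out of the row. -/
def raiseAfter (L : ℕ → ℕ) (j : ℕ) (x : ℕ) : ℕ := if x ≤ j then L x else max (L x) (L j + 1)

theorem lt_length_of_mem_vacant {T : List ℕ} {x : ℕ} (hx : x ∈ vacant T) : x < T.length := by
  induction T with
  | nil => simp [vacant] at hx
  | cons k T ih =>
    rcases k with _ | k
    · rcases Finset.mem_insert.1 hx with rfl | h
      · simp
      · have := ih h; simp; omega
    · have := ih hx; simp; omega

theorem firstRow_mono (T : List ℕ) : Monotone (firstRow T) := by
  induction T with
  | nil => exact monotone_const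
  | cons k T ih =>
    intro x y hxy
    have := ih hxy
    simp only [firstRow]
    split_ifs <;> omega

theorem firstRow_of_length_le (T : List ℕ) : ∀ {x : ℕ}, T.length ≤ x →
    firstRow T x = T.count 1 := by
  induction T with
  | nil => simp [firstRow]
  | cons k T ih =>
    intro x hx
    simp only [List.length_cons] at hx
    rw [firstRow, ih (by omega), List.count_cons]
    congr 1
    simp [show T.length < x by omega]

theorem length_of_mem_insertions (T : List ℕ) : ∀ p ∈ insertions T, p.1.length = T.length := by
  induction T with
  | nil => simp [insertions]
  | cons k T ih =>
    rcases k with _ | k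
    · intro p hp
      simp only [insertions, List.mem_cons, List.mem_map] at hp
      rcases hp with rfl | ⟨q, hq, rfl⟩
      · simp
      · simp [ih q hq]
    · intro p hp
      simp only [insertions, List.mem_map] at hp
      obtain ⟨q, hq, rfl⟩ := hp
      split_ifs <;> simp [ih q hq]

theorem firstRow_cons_of_ne_one {T : List ℕ} {k : ℕ} (hk : k ≠ 1) :
    firstRow (k :: T) = firstRow T := by
  funext x; simp [firstRow, hk]

/-- The third argument of `F` records whether the shape grows in the first row; the induction needs
it to see whether the next entry of the first row is bumped. -/
theorem sum_insertions_aux (T : List ℕ) : ∀ F : Finset ℕ → (ℕ → ℕ) → Prop → ℕ,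
    ((insertions T).map fun p => F (vacant p.1) (firstRow p.1) (p.2 = 0)).sum =
      ∑ j ∈ vacant T, F ((vacant T).erase j) (raiseAfter (firstRow T) j)
        (firstRow T j = firstRow T T.length) := by
  induction T with
  | nil => intro F; simp [insertions, vacant]
  | cons k T ih =>
    intro F
    have hlen := length_of_mem_insertions T
    rcases k with _ | k
    · have hn : T.length ∉ vacant T := fun h => (lt_length_of_mem_vacant h).false
      simp only [insertions, List.map_cons, List.map_map, List.sum_cons, vacant,
        Finset.sum_insert hn]
      congr 1
      · rw [Finset.erase_insert hn]
        congr 1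
        · funext x
          simp only [raiseAfter, firstRow]
          by_cases hx : x ≤ T.length
          · simp [hx]
          · rw [firstRow_of_length_le T (not_le.1 hx).le, firstRow_of_length_le T le_rfl]
            simp [hx]
        · simp [firstRow_cons_of_ne_one, firstRow_of_length_le]
      · have := ih fun A L P => F (insert T.length A) L P
        beta_reduce at this
        rw [Finset.sum_congr rfl fun j hj => ?_, ← this]
        · refine congrArg _ (List.map_congr_left fun p hp => ?_)
          simp [vacant, firstRow_cons_of_ne_one, hlen p hp]
        · have hj' := lt_length_of_mem_vacant hj
          rw [Finset.erase_insert_of_ne (by omega), firstRow_cons_of_ne_one (zero_ne_one)]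
          simp [firstRow_of_length_le]
    · simp only [insertions, List.map_map, vacant]
      rcases k with _ | k
      · have := ih fun A L P =>
          F A (fun x => L x + open Classical in if ¬ P ∧ T.length < x then 1 else 0) False
        beta_reduce at this
        rw [Finset.sum_congr rfl fun j hj => ?_, ← this]
        · refine congrArg _ (List.map_congr_left fun p hp => ?_)
          by_cases h0 : p.2 = 0
          · simp [h0, vacant, firstRow_cons_of_ne_one]
          · simp [h0, vacant, firstRow, hlen p hp]
        · have hj' := lt_length_of_mem_vacant hj
          have hm := firstRow_mono T hj'.le
          congr 1
          · funext x
            simp only [raiseAfter, firstRow, firstRow_of_length_le T le_rfl] at hm ⊢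
            by_cases hx : T.length < x
            · rw [firstRow_of_length_le T hx.le]
              simp [hx, show ¬ x ≤ j by omega, show ¬ T.length < j by omega]
              split_ifs <;> omega
            · simp [hx, show ¬ T.length < j by omega]
          · simp [firstRow, firstRow_of_length_le, show ¬ T.length < j by omega] at hm ⊢
            omega
      · have := ih fun A L P => F A L P
        beta_reduce at this
        rw [Finset.sum_congr rfl fun j hj => ?_, ← this]
        · refine congrArg _ (List.map_congr_left fun p hp => ?_)
          by_cases h0 : p.2 = k + 1
          · simp [h0, vacant, firstRow_cons_of_ne_one]
          · simp [h0, vacant, firstRow_cons_of_ne_one]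
        · rw [firstRow_cons_of_ne_one (by omega)]
          simp [firstRow_of_length_le]

theorem sum_insertions (T : List ℕ) (F : Finset ℕ → (ℕ → ℕ) → ℕ) :
    ((insertions T).map fun p => F (vacant p.1) (firstRow p.1)).sum =
      ∑ j ∈ vacant T, F ((vacant T).erase j) (raiseAfter (firstRow T) j) :=
  sum_insertions_aux T fun A L _ => F A L

/-! ### Involutions with bounded nestings -/

/-- `s` is a set of positions in `A` whose arcs `{p, τ p}`, for the involution `τ`, are nested. The
elements of `s` are the left ends of the arcs; if `w`, the innermost arc may be a fixed point. -/
structure IsNesting (w : Bool) (τ : Equiv.Perm ℕ) (A s : Finset ℕ) : Prop where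
  subset : s ⊆ A
  strictAntiOn : StrictAntiOn τ s
  lt_or_eq : ∀ p ∈ s, p < τ p ∨ w = true ∧ τ p = p

/-- The involutions supported on `A` such that every nesting `s` with all its left ends at least `q`
satisfies `L q + #s ≤ ℓ`. Here `L q` stands for the size of the largest nesting with left ends
before `q` among further arcs, whose right ends lie to the right of `A`. The empty nesting is
allowed, so `L` itself is bounded by `ℓ`. -/
def boundedInvolutions (w : Bool) (ℓ : ℕ) (A : Finset ℕ) (L : ℕ → ℕ) : Set (Equiv.Perm ℕ) :=
  {τ | Function.Involutive τ ∧ (∀ x ∉ A, τ x = x) ∧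
    ∀ q s, IsNesting w τ A s → (∀ p ∈ s, q ≤ p) → L q + s.card ≤ ℓ}

theorem finite_boundedInvolutions (w : Bool) (ℓ : ℕ) (A : Finset ℕ) (L : ℕ → ℕ) :
    (boundedInvolutions w ℓ A L).Finite := by
  have : Finite {f : Equiv.Perm ℕ // ∀ a, ¬ a ∈ A → f a = a} :=
    Finite.of_equiv _ (Equiv.Perm.subtypeEquivSubtypePerm (· ∈ A))
  have h : {f : Equiv.Perm ℕ | ∀ a, ¬ a ∈ A → f a = a}.Finite := this
  exact h.subset fun τ hτ => hτ.2.1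

section

variable {w : Bool} {ℓ n : ℕ} {A : Finset ℕ} {L : ℕ → ℕ}

theorem mem_boundedInvolutions_of_apply_eq (hA : ∀ x ∈ A, x < n) (hL : Monotone L)
    {τ : Equiv.Perm ℕ} (hτ : τ n = n) :
    τ ∈ boundedInvolutions w ℓ (insert n A) L ↔
      (w = true → L n < ℓ) ∧ τ ∈ boundedInvolutions w ℓ A L := by
  have hnA : n ∉ A := fun h => (hA n h).false
  constructor
  · rintro ⟨h1, h2, h3⟩
    refine ⟨fun hw => ?_, h1, fun x hx => ?_, fun q s hs hq => h3 q s
      ⟨hs.1.trans (Finset.subset_insert _ _), hs.2, hs.3⟩ hq⟩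
    · have := h3 n {n} ⟨by simp, by simp, by simp [hw, hτ]⟩ (by simp)
      simpa using this
    · by_cases hxn : x = n
      · rw [hxn, hτ]
      · exact h2 x (by simp [hxn, hx])
  · rintro ⟨hw, h1, h2, h3⟩
    refine ⟨h1, fun x hx => h2 x fun h => hx (Finset.mem_insert_of_mem h), fun q s hs hq => ?_⟩
    by_cases hns : n ∈ s
    · -- a nesting through the fixed point `n` has no other element
      have hsn : s = {n} := by
        refine Finset.eq_singleton_iff_unique_mem.2 ⟨hns, fun p hp => ?_⟩
        by_contra hpn
        have hpA := (Finset.mem_insert.1 (hs.1 hp)).resolve_left hpn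
        have h4 := hs.2 hp hns (hA p hpA)
        have h5 : τ p ∈ A := by
          by_contra h5
          have := h2 _ h5
          rw [h1 p] at this
          exact h5 (this ▸ hpA)
        have := hA _ h5
        omega
      have hw' : w = true := by simpa [hτ] using hs.3 n hns
      have := hL (hq n hns)
      have := hw hw'
      simp [hsn]
      omega
    · exact h3 q s ⟨fun p hp => (Finset.mem_insert.1 (hs.1 hp)).resolve_left
        (fun h => hns (h ▸ hp)), hs.2, hs.3⟩ hq

/-- An arc from `j` to the last position `n` encloses everything to the right of `j`, so it may be
deleted if its presence is recorded by raising `L` after `j`. -/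
theorem swap_mul_mem_boundedInvolutions (hA : ∀ x ∈ A, x < n) (hL : Monotone L)
    {j : ℕ} (hj : j ∈ A) {σ : Equiv.Perm ℕ} (hσn : σ n = n) (hσj : σ j = j) :
    Equiv.swap n j * σ ∈ boundedInvolutions w ℓ (insert n A) L ↔
      σ ∈ boundedInvolutions w ℓ (A.erase j) (raiseAfter L j) := by
  have hjn := hA j hj
  set τ := Equiv.swap n j * σ with hτ
  have hτn : τ n = j := by simp [hτ, hσn]
  have hτj : τ j = n := by simp [hτ, hσj]
  have hne : ∀ x, x ≠ n → x ≠ j → σ x ≠ n ∧ σ x ≠ j := fun x h1 h2 =>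
    ⟨fun h => h1 (σ.injective (h.trans hσn.symm)), fun h => h2 (σ.injective (h.trans hσj.symm))⟩
  have hτx : ∀ x, x ≠ n → x ≠ j → τ x = σ x := fun x h1 h2 => by
    rw [hτ, Equiv.Perm.mul_apply, Equiv.swap_apply_of_ne_of_ne (hne x h1 h2).1 (hne x h1 h2).2]
  have hinv : Function.Involutive τ ↔ Function.Involutive σ := by
    refine forall_congr' fun x => ?_
    by_cases h1 : x = n
    · simp [h1, hτn, hτj, hσn]
    by_cases h2 : x = j
    · simp [h2, hτn, hτj, hσj]
    rw [hτx x h1 h2, hτx _ (hne x h1 h2).1 (hne x h1 h2).2]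
  have hfix : (∀ x ∉ insert n A, τ x = x) ↔ ∀ x ∉ A.erase j, σ x = x := by
    refine forall_congr' fun x => ?_
    by_cases h1 : x = n
    · simp [h1, hσn]
    by_cases h2 : x = j
    · simp [h2, hσj, hj]
    simp [h1, h2, hτx]
  have hlt : ∀ x, Function.Involutive τ → (∀ x ∉ insert n A, τ x = x) → x ∈ insert n A →
      τ x ≤ n := by
    intro x h1 h2 hx
    have h5 : τ x ∈ insert n A := by
      by_contra h5
      have := h2 _ h5
      rw [h1 x] at this
      exact h5 (this ▸ hx)
    rcases Finset.mem_insert.1 h5 with h | h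
    · exact h.le
    · exact (hA _ h).le
  constructor
  · rintro ⟨h1, h2, h3⟩
    refine ⟨hinv.1 h1, hfix.1 h2, fun q s hs hq => ?_⟩
    have hsA : ∀ p ∈ s, p ∈ A ∧ p ≠ n ∧ p ≠ j := fun p hp => by
      have := Finset.mem_erase.1 (hs.1 hp)
      exact ⟨this.2, (hA p this.2).ne, this.1⟩
    have hst : ∀ p ∈ s, τ p = σ p := fun p hp => hτx p (hsA p hp).2.1 (hsA p hp).2.2
    have hs' : IsNesting w τ (insert n A) s := by
      refine ⟨fun p hp => Finset.mem_insert_of_mem (hsA p hp).1, fun a ha b hb hab => ?_,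
        fun p hp => ?_⟩
      · rw [hst a ha, hst b hb]; exact hs.2 ha hb hab
      · rw [hst p hp]; exact hs.3 p hp
    have hLq := h3 q s hs' hq
    rw [raiseAfter]
    split_ifs with hqj
    · exact hLq
    -- the arc from `j` to `n` encloses the nesting
    have hjs : j ∉ s := fun h => (hsA j h).2.2 rfl
    have hs2 : IsNesting w τ (insert n A) (insert j s) := by
      refine ⟨?_, ?_, ?_⟩
      · intro p hp
        rcases Finset.mem_insert.1 hp with rfl | hp
        · simp [hj]
        · exact hs'.1 hp
      · have hlt' : ∀ b ∈ s, τ b < n := fun b hb => by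
          refine lt_of_le_of_ne (hlt b h1 h2 (hs'.1 hb)) fun h => (hsA b hb).2.2 ?_
          exact τ.injective (h.trans hτj.symm)
        intro a ha b hb hab
        rcases Finset.mem_insert.1 ha with rfl | ha
        · rcases Finset.mem_insert.1 hb with rfl | hb
          · exact (hab.false).elim
          · rw [hτj]; exact hlt' b hb
        · rcases Finset.mem_insert.1 hb with hb | hb
          · have := hq a ha; omega
          · exact hs'.2 ha hb hab
      · intro p hp
        rcases Finset.mem_insert.1 hp with rfl | hp
        · left; omega
        · exact hs'.3 p hp
    have := h3 j (insert j s) hs2 fun p hp => by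
      rcases Finset.mem_insert.1 hp with rfl | hp
      · exact le_rfl
      · have := hq p hp; omega
    rw [Finset.card_insert_of_notMem hjs] at this
    omega
  · rintro ⟨h1, h2, h3⟩
    refine ⟨hinv.2 h1, hfix.2 h2, fun q s hs hq => ?_⟩
    have hns : n ∉ s := fun h => by
      have := hs.3 n h
      rw [hτn] at this
      omega
    have hsub : ∀ t ⊆ s, j ∉ t → IsNesting w σ (A.erase j) t := by
      intro t ht hjt
      have hne' : ∀ p ∈ t, p ≠ n ∧ p ≠ j := fun p hp =>
        ⟨fun h => hns (h ▸ ht hp), fun h => hjt (h ▸ hp)⟩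
      have hst : ∀ p ∈ t, σ p = τ p := fun p hp => (hτx p (hne' p hp).1 (hne' p hp).2).symm
      refine ⟨fun p hp => Finset.mem_erase.2 ⟨(hne' p hp).2,
        (Finset.mem_insert.1 (hs.1 (ht hp))).resolve_left (hne' p hp).1⟩,
        fun a ha b hb hab => ?_, fun p hp => ?_⟩
      · rw [hst a ha, hst b hb]; exact hs.2 (ht ha) (ht hb) hab
      · rw [hst p hp]; exact hs.3 p (ht hp)
    by_cases hjs : j ∈ s
    · have := h3 (j + 1) (s.erase j) (hsub _ (Finset.erase_subset _ _) (by simp)) fun p hp => by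
        have hp := Finset.mem_erase.1 hp
        by_contra hpj
        have := hs.2 hp.2 hjs (by omega)
        have := hlt p (hinv.2 h1) (hfix.2 h2) (hs.1 hp.2)
        omega
      rw [raiseAfter, if_neg (by omega), Finset.card_erase_of_mem hjs] at this
      have := hL (hq j hjs)
      have := Finset.card_pos.2 ⟨j, hjs⟩
      omega
    · have := h3 q s (hsub s subset_rfl hjs) hq
      rw [raiseAfter] at this
      split_ifs at this <;> omega

theorem ncard_boundedInvolutions_insert (hA : ∀ x ∈ A, x < n) (hL : Monotone L) :
    (boundedInvolutions w ℓ (insert n A) L).ncard =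
      (if w = true → L n < ℓ then (boundedInvolutions w ℓ A L).ncard else 0) +
        ∑ j ∈ A, (boundedInvolutions w ℓ (A.erase j) (raiseAfter L j)).ncard := by
  have hnA : n ∉ A := fun h => (hA n h).false
  have hfin := finite_boundedInvolutions w ℓ (insert n A) L
  have hmaps : ∀ τ ∈ boundedInvolutions w ℓ (insert n A) L, τ n ∈ insert n A := by
    intro τ hτ
    by_contra h
    have h1 := hτ.2.1 _ h
    rw [hτ.1 n] at h1
    exact h (h1 ▸ Finset.mem_insert_self n A)
  have hsum : (boundedInvolutions w ℓ (insert n A) L).ncard =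
      ∑ j ∈ insert n A, {τ ∈ boundedInvolutions w ℓ (insert n A) L | τ n = j}.ncard := by
    classical
    rw [Set.ncard_eq_toFinset_card _ hfin, Finset.card_eq_sum_card_fiberwise (t := insert n A)
      (f := fun τ : Equiv.Perm ℕ => τ n) fun τ hτ => hmaps τ (by simpa using hτ)]
    refine Finset.sum_congr rfl fun j _ => ?_
    rw [← Set.ncard_coe_finset]
    congr 1
    ext τ
    simp
  rw [hsum, Finset.sum_insert hnA]
  congr 1
  · split_ifs with hw
    · congr 1
      ext τ
      constructor
      · rintro ⟨h1, h2⟩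
        exact ((mem_boundedInvolutions_of_apply_eq hA hL h2).1 h1).2
      · intro h
        have hn := h.2.1 n hnA
        exact ⟨(mem_boundedInvolutions_of_apply_eq hA hL hn).2 ⟨hw, h⟩, hn⟩
    · rw [Set.ncard_eq_zero (hfin.subset fun τ h => h.1), Set.eq_empty_iff_forall_notMem]
      rintro τ ⟨h1, h2⟩
      exact hw ((mem_boundedInvolutions_of_apply_eq hA hL h2).1 h1).1
  · refine Finset.sum_congr rfl fun j hj => ?_
    rw [← Set.ncard_image_of_injective (boundedInvolutions w ℓ (A.erase j) (raiseAfter L j))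
      (mul_right_injective (Equiv.swap n j))]
    congr 1
    ext τ
    constructor
    · rintro ⟨h1, h2⟩
      have h3 : τ j = n := by rw [← h2]; exact h1.1 n
      refine ⟨Equiv.swap n j * τ, ?_, by simp [← mul_assoc]⟩
      rw [← swap_mul_mem_boundedInvolutions hA hL hj (by simp [h2]) (by simp [h3])]
      simpa [← mul_assoc] using h1
    · rintro ⟨σ, hσ, rfl⟩
      have h1 := hσ.2.1 n fun h => hnA (Finset.mem_of_mem_erase h)
      exact ⟨(swap_mul_mem_boundedInvolutions hA hL hj h1 (hσ.2.1 j (by simp))).2 hσ,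
        by simp [h1]⟩

end

/-- The largest nesting, with left ends before `q`, among the arcs whose left ends form the tableau
`T` is given by `firstRow T q`; this is Schensted's theorem, built up one insertion at a time through
`raiseAfter`. -/
theorem completionCount_eq_ncard (w : Bool) (ℓ n : ℕ) : ∀ T : List ℕ, T.length = n →
    completionCount w ℓ n T = (boundedInvolutions w ℓ (vacant T) (firstRow T)).ncard := by
  induction n with
  | zero =>
    intro T hT
    obtain rfl := List.length_eq_zero_iff.1 hT
    have : boundedInvolutions w ℓ (vacant []) (firstRow []) = {1} := by
      ext τ
      constructor
      · rintro ⟨_, h, _⟩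
        exact Equiv.ext fun x => h x (by simp [vacant])
      · rintro rfl
        refine ⟨fun x => rfl, fun x _ => rfl, fun q s hs _ => ?_⟩
        simp [Finset.subset_empty.1 hs.1, firstRow]
    rw [this, Set.ncard_singleton, completionCount]
  | succ n ih =>
    intro T hT
    have hempty : ℓ < T.count 1 →
        (boundedInvolutions w ℓ (vacant T) (firstRow T)).ncard = 0 := by
      intro h
      rw [Set.ncard_eq_zero (finite_boundedInvolutions _ _ _ _), Set.eq_empty_iff_forall_notMem]
      rintro τ ⟨_, _, h3⟩
      have := h3 T.length ∅ ⟨by simp, fun a ha => by simp at ha, by simp⟩ (by simp)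
      rw [firstRow_of_length_le T le_rfl] at this
      simp at this
      omega
    rcases T with _ | ⟨_ | k, T⟩
    · simp at hT
    · have hT' : T.length = n := by simpa using hT
      have hn := firstRow_of_length_le T le_rfl
      have hc : (0 :: T).count 1 = T.count 1 := by simp
      rw [completionCount, vacant, firstRow_cons_of_ne_one zero_ne_one]
      have hrec := ncard_boundedInvolutions_insert (w := w) (ℓ := ℓ) (A := vacant T)
        (fun x => lt_length_of_mem_vacant) (firstRow_mono T)
      rw [hn, ← sum_insertions T fun A L => (boundedInvolutions w ℓ A L).ncard] at hrec
      split_ifs with h1 h2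
      · rw [hrec, if_pos h2, ih T hT']
        congr 2
        exact List.map_congr_left fun p hp => ih _ ((length_of_mem_insertions T p hp).trans hT')
      · rw [hrec, if_neg h2]
        congr 2
        exact List.map_congr_left fun p hp => ih _ ((length_of_mem_insertions T p hp).trans hT')
      · rw [hc, vacant, firstRow_cons_of_ne_one zero_ne_one] at hempty
        exact (hempty (not_le.1 h1)).symm
    · have hT' : T.length = n := by simpa using hT
      rw [completionCount]
      split_ifs with h1
      · rw [ih T hT']
        congr 1
        ext τ
        refine and_congr_right fun _ => and_congr_right fun _ => forall_congr' fun q =>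
          forall_congr' fun s => forall_congr' fun hs => forall_congr' fun hq => ?_
        by_cases hqn : q ≤ T.length
        · simp [firstRow, hqn.not_gt]
        · -- beyond the last position only the empty nesting is left
          have hs0 : s = ∅ := by
            refine Finset.eq_empty_of_forall_notMem fun p hp => ?_
            have := hq p hp
            have := lt_length_of_mem_vacant (hs.1 hp)
            omega
          rw [firstRow_of_length_le T (by omega), firstRow_of_length_le _ (by simp; omega), hs0]
          rw [List.count_cons] at h1 ⊢
          simp only [Finset.card_empty]
          omega
      · exact (hempty (not_le.1 h1)).symm

/-! ### Nestings and descending subsequences -/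

theorem tableauSum_zero (n : ℕ) : ∀ F : List ℕ → ℕ,
    tableauSum n 0 F = F (List.replicate n 0) := by
  induction n with
  | zero => intro F; simp [tableauSum]
  | succ n ih => intro F; simp [tableauSum, ih, removableRows, List.replicate_succ]

theorem vacant_replicate (n : ℕ) : vacant (List.replicate n 0) = Finset.range n := by
  induction n with
  | zero => rfl
  | succ n ih => rw [List.replicate_succ, vacant, ih, List.length_replicate, Finset.range_add_one]

theorem firstRow_replicate (n : ℕ) : firstRow (List.replicate n 0) = fun _ => 0 := by
  induction n with
  | zero => rfl
  | succ n ih => rw [List.replicate_succ, firstRow_cons_of_ne_one zero_ne_one, ih]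

theorem tableauWeight_eq_ncard (w : Bool) (ℓ n : ℕ) :
    tableauWeight w ℓ n 0 = (boundedInvolutions w ℓ (Finset.range n) fun _ => 0).ncard := by
  rw [tableauWeight, tableauSum_zero, completionCount_eq_ncard w ℓ n _ (by simp), vacant_replicate,
    firstRow_replicate]

theorem forall_isNesting_iff (w : Bool) {σ : Equiv.Perm ℕ} (hσ : Function.Involutive σ)
    {A : Finset ℕ} (hA : ∀ x ∉ A, σ x = x) (ℓ : ℕ) :
    (∀ s, IsNesting w σ A s → s.card ≤ ℓ) ↔
      ∀ s ⊆ A, StrictAntiOn σ s → s.card ≤ if w then 2 * ℓ else 2 * ℓ + 1 := by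
  have hmaps : ∀ x ∈ A, σ x ∈ A := by
    intro x hx
    by_contra h
    have := hA _ h
    rw [hσ x] at this
    exact h (this ▸ hx)
  have hfix : ∀ {s : Finset ℕ}, StrictAntiOn σ s → ∀ x ∈ s, ∀ y ∈ s, σ x = x → σ y = y → x = y := by
    intro s hs x hx y hy h1 h2
    rcases lt_trichotomy x y with h | h | h
    · have := hs hx hy h; omega
    · exact h
    · have := hs hy hx h; omega
  constructor
  · intro h s hsA hs
    -- the elements of `s` with `p < σ p`, and the images of those with `σ p < p`, form nestings;
    -- a fixed point may join either if `w`
    let P : ℕ → Prop := fun p => p < σ p ∨ w = true ∧ σ p = p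
    let Q : ℕ → Prop := fun p => σ p < p ∨ w = true ∧ σ p = p
    have h1 : (s.filter P).card ≤ ℓ := h _
      ⟨(Finset.filter_subset _ _).trans hsA, hs.mono fun x hx => (Finset.mem_filter.1 hx).1,
        fun p hp => (Finset.mem_filter.1 hp).2⟩
    have h2 : (s.filter Q).card ≤ ℓ := by
      rw [← Finset.card_image_of_injective _ σ.injective]
      refine h _ ⟨fun x hx => ?_, ?_, fun x hx => ?_⟩
      · obtain ⟨p, hp, rfl⟩ := Finset.mem_image.1 hx
        exact hmaps p (hsA (Finset.mem_filter.1 hp).1)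
      · intro x hx y hy hxy
        obtain ⟨p, hp, rfl⟩ := Finset.mem_image.1 hx
        obtain ⟨q, hq, rfl⟩ := Finset.mem_image.1 hy
        rw [hσ, hσ]
        exact (hs.lt_iff_gt (Finset.mem_filter.1 hp).1 (Finset.mem_filter.1 hq).1).1 hxy
      · obtain ⟨p, hp, rfl⟩ := Finset.mem_image.1 hx
        rw [hσ]
        exact (Finset.mem_filter.1 hp).2.imp id fun h => ⟨h.1, h.2.symm⟩
    cases w
    · have h3 : (s.filter fun p => σ p = p).card ≤ 1 := Finset.card_le_one.2 fun x hx y hy =>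
        hfix hs x (Finset.mem_filter.1 hx).1 y (Finset.mem_filter.1 hy).1
          (Finset.mem_filter.1 hx).2 (Finset.mem_filter.1 hy).2
      have h4 : s ⊆ s.filter P ∪ s.filter Q ∪ s.filter fun p => σ p = p := by
        intro p hp
        simp [P, Q, hp]
        omega
      have h5 := Finset.card_le_card h4
      have h6 := Finset.card_union_le (s.filter P ∪ s.filter Q) (s.filter fun p => σ p = p)
      have h7 := Finset.card_union_le (s.filter P) (s.filter Q)
      simp
      omega
    · have h4 : s ⊆ s.filter P ∪ s.filter Q := by
        intro p hp
        simp [P, Q, hp]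
        omega
      have h5 := Finset.card_le_card h4
      have h7 := Finset.card_union_le (s.filter P) (s.filter Q)
      simp
      omega
  · intro h s hs
    have hle : ∀ p ∈ s, p ≤ σ p := fun p hp => by
      rcases hs.3 p hp with h | h
      · exact h.le
      · exact h.2.ge
    -- every left end precedes every right end
    have hcross : ∀ a ∈ s, ∀ p ∈ s, p ≤ σ a := by
      intro a ha p hp
      rcases le_total a p with hap | hap
      · exact (hle p hp).trans (hs.2.antitoneOn ha hp hap)
      · exact hap.trans (hle a ha)
    have h1 := h (s ∪ s.image σ) ?_ ?_
    · have h2 := Finset.card_union_add_card_inter s (s.image σ)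
      rw [Finset.card_image_of_injective _ σ.injective] at h2
      have h3 : ∀ x ∈ s ∩ s.image σ, x ∈ s ∧ σ x = x := by
        intro x hx
        obtain ⟨hx, hx'⟩ := Finset.mem_inter.1 hx
        obtain ⟨p, hp, rfl⟩ := Finset.mem_image.1 hx'
        have := hle _ hx
        have := hle _ hp
        rw [hσ] at *
        exact ⟨hx, by omega⟩
      have h4 : (s ∩ s.image σ).card ≤ 1 := Finset.card_le_one.2 fun x hx y hy =>
        hfix hs.2 x (h3 x hx).1 y (h3 y hy).1 (h3 x hx).2 (h3 y hy).2
      cases w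
      · have h5 : s ∩ s.image σ = ∅ := Finset.eq_empty_of_forall_notMem fun x hx => by
          have := hs.3 x (h3 x hx).1
          have := (h3 x hx).2
          simp at *
          omega
        rw [h5] at h2
        simp at h1 h2
        omega
      · simp at h1
        omega
    · refine Finset.union_subset hs.1 fun x hx => ?_
      obtain ⟨p, hp, rfl⟩ := Finset.mem_image.1 hx
      exact hmaps p (hs.1 hp)
    · intro a ha b hb hab
      simp only [Finset.coe_union, Finset.coe_image, Set.mem_union, Finset.mem_coe,
        Set.mem_image] at ha hb
      rcases ha with ha | ⟨p, hp, rfl⟩ <;> rcases hb with hb | ⟨q, hq, rfl⟩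
      · exact hs.2 ha hb hab
      · rw [hσ]
        refine lt_of_le_of_ne (hcross a ha q hq) fun h => ?_
        rw [h, hσ] at hab
        exact hab.false
      · have := hcross p hp b hb
        omega
      · rw [hσ, hσ]
        exact (hs.2.lt_iff_gt hp hq).1 hab

theorem hasDescendingSubsequence_iff {n k : ℕ} (τ : Equiv.Perm (Fin n)) (σ : Equiv.Perm ℕ)
    (hσ : ∀ i : Fin n, σ i = τ i) :
    HasDescendingSubsequence τ k ↔ ∃ s ⊆ Finset.range n, StrictAntiOn σ s ∧ k ≤ s.card := by
  constructor
  · rintro ⟨p, hp, hτ⟩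
    refine ⟨Finset.univ.image fun a => (p a : ℕ), ?_, ?_, ?_⟩
    · intro x hx
      obtain ⟨a, _, rfl⟩ := Finset.mem_image.1 hx
      simp
    · intro x hx y hy hxy
      simp only [Finset.coe_image, Finset.coe_univ, Set.image_univ, Set.mem_range] at hx hy
      obtain ⟨a, rfl⟩ := hx
      obtain ⟨b, rfl⟩ := hy
      rw [hσ, hσ]
      exact hτ (hp.lt_iff_lt.1 hxy)
    · rw [Finset.card_image_of_injective _ fun a b h => hp.injective (Fin.ext h)]
      simp
  · rintro ⟨s, hs, hanti, hk⟩
    obtain ⟨t, hts, ht⟩ := Finset.exists_subset_card_eq hk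
    have hmem : ∀ a, t.orderEmbOfFin ht a ∈ t := fun a => t.orderEmbOfFin_mem ht a
    refine ⟨fun a => ⟨t.orderEmbOfFin ht a, Finset.mem_range.1 (hs (hts (hmem a)))⟩,
      fun a b hab => ?_, fun a b hab => ?_⟩
    · exact Fin.lt_def.2 ((t.orderEmbOfFin ht).lt_iff_lt.2 hab)
    · rw [Fin.lt_def, ← hσ, ← hσ]
      exact hanti (hts (hmem a)) (hts (hmem b))
        ((t.orderEmbOfFin ht).lt_iff_lt.2 hab)

theorem ncard_avoidingInvolutions (w : Bool) (ℓ n : ℕ) :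
    (avoidingInvolutions (if w then 2 * ℓ else 2 * ℓ + 1) n).ncard = tableauWeight w ℓ n 0 := by
  rw [tableauWeight_eq_ncard]
  have hmem : ∀ (τ : Equiv.Perm (Fin n)) (σ : Equiv.Perm ℕ), (∀ i : Fin n, σ i = τ i) →
      (∀ x ∉ Finset.range n, σ x = x) →
      (τ ∈ avoidingInvolutions (if w then 2 * ℓ else 2 * ℓ + 1) n ↔
        σ ∈ boundedInvolutions w ℓ (Finset.range n) fun _ => 0) := by
    intro τ σ h1 h2
    have hinv : Function.Involutive τ ↔ Function.Involutive σ := by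
      constructor
      · intro h x
        by_cases hx : x < n
        · have e : ∀ i : Fin n, σ (σ i) = i := fun i => by rw [h1, h1, h]
          exact e ⟨x, hx⟩
        · rw [h2 x (by simpa using hx), h2 x (by simpa using hx)]
      · intro h i
        have := h i
        rw [h1, h1] at this
        exact Fin.ext this
    rw [avoidingInvolutions, boundedInvolutions, Set.mem_ofPred_eq, Set.mem_ofPred_eq, hinv]
    refine and_congr_right fun h => ?_
    rw [hasDescendingSubsequence_iff τ σ h1, and_iff_right h2]
    have := forall_isNesting_iff w h h2 ℓ
    push Not
    simp only [Nat.lt_succ_iff] at *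
    rw [← this]
    exact ⟨fun h q s hs _ => by simpa using h s hs,
      fun h s hs => by simpa using h 0 s hs fun _ _ => Nat.zero_le _⟩
  have hval : ∀ (τ : Equiv.Perm (Fin n)) (i : Fin n), τ.extendDomain Fin.equivSubtype i = τ i :=
    fun τ i => τ.extendDomain_apply_image Fin.equivSubtype i
  have hout : ∀ (τ : Equiv.Perm (Fin n)), ∀ x ∉ Finset.range n,
      τ.extendDomain Fin.equivSubtype x = x := fun τ x hx =>
    τ.extendDomain_apply_not_subtype Fin.equivSubtype (by simpa using hx)
  refine Set.ncard_congr (fun τ _ => τ.extendDomain Fin.equivSubtype) ?_ ?_ ?_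
  · exact fun τ hτ => (hmem τ _ (hval τ) (hout τ)).1 hτ
  · exact fun τ τ' _ _ h => Equiv.Perm.extendDomainHom_injective Fin.equivSubtype h
  · intro σ hσ
    have hlt : ∀ x, σ x < n ↔ x < n := fun x => by
      rw [← not_iff_not]
      have h2 : ∀ x, ¬ x < n → σ x = x := fun x hx => hσ.2.1 x (by simpa using hx)
      refine ⟨fun h => ?_, fun h => by rwa [h2 x h]⟩
      have := h2 _ h
      rw [hσ.1 x] at this
      rwa [this]
    let τ : Equiv.Perm (Fin n) := Fin.equivSubtype.symm.permCongr (σ.subtypePerm hlt)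
    have hτ : τ.extendDomain Fin.equivSubtype = σ := by
      ext x
      by_cases hx : x < n
      · exact hval τ ⟨x, hx⟩
      · rw [hout τ x (by simpa using hx), hσ.2.1 x (by simpa using hx)]
    refine ⟨τ, (hmem τ σ (fun i => ?_) hσ.2.1).2 hσ, hτ⟩
    rw [← hval, hτ]

/-! ### The Bessel series and derivatives of determinants -/

/-- `1 / z!`, extended by `0` to the negative integers. -/
noncomputable def invFactorial (z : ℤ) : ℚ := if 0 ≤ z then 1 / (z.toNat ! : ℚ) else 0

theorem mul_invFactorial (z : ℤ) : (z : ℚ) * invFactorial z = invFactorial (z - 1) := by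
  rcases lt_trichotomy z 0 with h | rfl | h
  · simp [invFactorial, h.not_ge, show ¬ 1 ≤ z by omega]
  · simp [invFactorial]
  · obtain ⟨k, rfl⟩ : ∃ k : ℕ, z = k + 1 := ⟨(z - 1).toNat, by omega⟩
    rw [invFactorial, invFactorial, if_pos h.le, if_pos (by omega),
      show ((k : ℤ) + 1).toNat = k + 1 by omega, show ((k : ℤ) + 1 - 1).toNat = k by omega,
      Nat.factorial_succ]
    have := Nat.factorial_ne_zero k
    push_cast
    field_simp

theorem coeff_besselSeries {k : ℕ} {i a : ℤ} (h : (k : ℤ) = 2 * a + i) :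
    PowerSeries.coeff k (besselSeries i) = invFactorial a * invFactorial (a + i) := by
  rw [besselSeries, PowerSeries.coeff_mk]
  by_cases ha : 0 ≤ a ∧ 0 ≤ a + i
  · rw [Finset.sum_eq_single a.toNat]
    · rw [invFactorial, invFactorial, if_pos ha.1, if_pos ha.2, Int.toNat_of_nonneg ha.1]
      field_simp
    · intro b hb hba
      rw [Finset.mem_filter] at hb
      omega
    · intro hb
      exfalso
      apply hb
      rw [Finset.mem_filter, Finset.mem_range]
      omega
  · rw [Finset.sum_eq_zero]
    · rw [invFactorial, invFactorial]
      split_ifs <;> first | omega | simp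
    · intro b hb
      rw [Finset.mem_filter] at hb
      omega

theorem coeff_besselSeries_of_odd {k : ℕ} {i a : ℤ} (h : (k : ℤ) = 2 * a + 1 + i) :
    PowerSeries.coeff k (besselSeries i) = 0 := by
  rw [besselSeries, PowerSeries.coeff_mk, Finset.sum_eq_zero]
  intro b hb
  rw [Finset.mem_filter] at hb
  omega

theorem besselSeries_neg (i : ℤ) : besselSeries (-i) = besselSeries i := by
  ext k
  rcases Int.emod_two_eq_zero_or_one (k - i) with h | h
  · rw [coeff_besselSeries (a := (k - i) / 2 + i) (by omega),
      coeff_besselSeries (a := (k - i) / 2) (by omega), mul_comm, add_neg_cancel_right]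
  · rw [coeff_besselSeries_of_odd (a := (k - i) / 2 + i) (by omega),
      coeff_besselSeries_of_odd (a := (k - i) / 2) (by omega)]

theorem coeff_zero_besselSeries (i : ℤ) :
    PowerSeries.coeff 0 (besselSeries i) = if i = 0 then 1 else 0 := by
  rcases Int.emod_two_eq_zero_or_one i with h | h
  · rw [coeff_besselSeries (a := - (i / 2)) (by push_cast; omega), invFactorial, invFactorial]
    split_ifs <;> first | omega | simp
    subst i
    simp
  · rw [coeff_besselSeries_of_odd (a := - (i / 2) - 1) (by push_cast; omega), if_neg (by omega)]

theorem derivative_besselSeries (i : ℤ) :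
    PowerSeries.derivative ℚ (besselSeries i) = besselSeries (i + 1) + besselSeries (i - 1) := by
  ext k
  rw [PowerSeries.coeff_derivative, map_add]
  rcases Int.emod_two_eq_zero_or_one (k + 1 - i) with h | h
  · obtain ⟨a, ha⟩ : ∃ a, (k + 1 - i : ℤ) = 2 * a := ⟨(k + 1 - i) / 2, by omega⟩
    rw [coeff_besselSeries (a := a) (by push_cast; omega),
      coeff_besselSeries (a := a - 1) (by omega), coeff_besselSeries (a := a) (by omega),
      ← mul_invFactorial a, show a - 1 + (i + 1) = a + i by omega,
      show a + (i - 1) = a + i - 1 by omega, ← mul_invFactorial (a + i)]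
    have : ((k : ℚ) + 1) = a + (a + i) := by exact_mod_cast (by omega : (k + 1 : ℤ) = a + (a + i))
    rw [this]
    push_cast
    ring
  · obtain ⟨a, ha⟩ : ∃ a, (k + 1 - i : ℤ) = 2 * a + 1 := ⟨(k + 1 - i) / 2, by omega⟩
    rw [coeff_besselSeries_of_odd (a := a) (by push_cast; omega),
      coeff_besselSeries_of_odd (a := a - 1) (by omega),
      coeff_besselSeries_of_odd (a := a) (by omega)]
    simp

theorem Derivation.map_finset_prod {R A ι : Type*} [CommSemiring R] [CommSemiring A] [Algebra R A]
    [DecidableEq ι] (D : Derivation R A A) (s : Finset ι) (f : ι → A) :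
    D (∏ i ∈ s, f i) = ∑ i ∈ s, D (f i) * ∏ j ∈ s.erase i, f j := by
  induction s using Finset.induction_on with
  | empty => simp
  | insert a s ha ih =>
    rw [Finset.prod_insert ha, D.leibniz, ih, Finset.sum_insert ha, Finset.erase_insert ha,
      smul_eq_mul, smul_eq_mul, add_comm, mul_comm, Finset.mul_sum]
    congr 1
    refine Finset.sum_congr rfl fun i hi => ?_
    rw [Finset.erase_insert_of_ne (by rintro rfl; exact ha hi), Finset.prod_insert (by simp [ha])]
    ring

theorem Derivation.map_det {R A ι : Type*} [CommRing R] [CommRing A] [Algebra R A]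
    [DecidableEq ι] [Fintype ι] (D : Derivation R A A) (M : Matrix ι ι A) :
    D M.det = ∑ i, (M.updateCol i fun j => D (M j i)).det := by
  simp only [Matrix.det_apply, map_sum, map_zsmul, Units.smul_def]
  rw [Finset.sum_comm]
  refine Finset.sum_congr rfl fun σ _ => ?_
  rw [D.map_finset_prod, Finset.smul_sum]
  refine Finset.sum_congr rfl fun i _ => ?_
  congr 1
  rw [← Finset.mul_prod_erase _ _ (Finset.mem_univ i), Matrix.updateCol_self]
  congr 1
  refine Finset.prod_congr rfl fun j hj => ?_
  rw [Matrix.updateCol_ne (Finset.ne_of_mem_erase hj)]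

/-! ### Walks in the chamber by reflection -/

/-- For positive `x` and `y`, the exponential generating function of the walks from `y` to `x` with
steps `± 1` on the positive integers, by the reflection principle: the wall at `0` absorbs if `w` is
`false`, and if `w` is `true` a step from `1` to `0` stays at `1` instead. -/
noncomputable def reflectedSeries (w : Bool) (x y : ℤ) : PowerSeries ℚ :=
  if w then besselSeries (x - y) + besselSeries (x + y - 1)
  else besselSeries (x - y) - besselSeries (x + y)

theorem derivative_reflectedSeries (w : Bool) (x y : ℤ) :
    PowerSeries.derivative ℚ (reflectedSeries w x y) =
      reflectedSeries w (x + 1) y + reflectedSeries w (x - 1) y := by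
  have e1 : x + 1 - y = x - y + 1 := by ring
  have e2 : x - 1 - y = x - y - 1 := by ring
  have e3 : x + 1 + y = x + y + 1 := by ring
  have e4 : x - 1 + y = x + y - 1 := by ring
  have e5 : x + y + 1 - 1 = x + y - 1 + 1 := by ring
  cases w <;>
  · simp only [reflectedSeries, if_true, if_false, map_add, map_sub, derivative_besselSeries,
      e1, e2, e3, e4, e5, Bool.false_eq_true]
    ring

theorem reflectedSeries_zero (w : Bool) (y : ℤ) :
    reflectedSeries w 0 y = if w then reflectedSeries w 1 y else 0 := by
  cases w
  · simp [reflectedSeries, besselSeries_neg]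
  · have := besselSeries_neg (y - 1)
    rw [neg_sub] at this
    simp [reflectedSeries, besselSeries_neg, this, add_comm]

theorem coeff_zero_reflectedSeries (w : Bool) {x y : ℤ} (hx : 0 < x) (hy : 0 < y) :
    PowerSeries.coeff 0 (reflectedSeries w x y) = if x = y then 1 else 0 := by
  have h1 : ¬ x + y - 1 = 0 := by omega
  have h2 : ¬ x + y = 0 := by omega
  cases w <;>
  simp only [reflectedSeries, if_true, if_false, Bool.false_eq_true, map_add, map_sub,
    coeff_zero_besselSeries, h1, h2, sub_eq_zero, add_zero, sub_zero]

/-- The matrix of `reflectedSeries` from the coordinates `ℓ - i` of the empty partition to the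
coordinates `x j`. Only the values `x j` with `j < ℓ` matter; `x` is defined on `ℕ` so that
coordinates can be addressed by column numbers. -/
noncomputable def walkMatrix (w : Bool) (ℓ : ℕ) (x : ℕ → ℤ) :
    Matrix (Fin ℓ) (Fin ℓ) (PowerSeries ℚ) :=
  Matrix.of fun i j => reflectedSeries w (x j) (ℓ - i)

/-- The generating function of the walks to `x` in the chamber `x 0 > ⋯ > x (ℓ - 1) > 0`; the factor
`exp` accounts for the unrestricted staying steps in the case `w = false`. -/
noncomputable def walkSeries (w : Bool) (ℓ : ℕ) (x : ℕ → ℤ) : PowerSeries ℚ :=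
  (if w then 1 else PowerSeries.exp ℚ) * (walkMatrix w ℓ x).det

theorem walkSeries_eq_zero_of_eq (w : Bool) {ℓ : ℕ} {x : ℕ → ℤ} {i j : ℕ} (hi : i < ℓ) (hj : j < ℓ)
    (hij : i ≠ j) (h : x i = x j) : walkSeries w ℓ x = 0 := by
  rw [walkSeries, Matrix.det_zero_of_column_eq (i := ⟨i, hi⟩) (j := ⟨j, hj⟩) (by simpa using hij),
    mul_zero]
  intro k
  simp [walkMatrix, h]

theorem walkMatrix_update (w : Bool) {ℓ : ℕ} (x : ℕ → ℤ) (j : Fin ℓ) (z : ℤ) :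
    walkMatrix w ℓ (Function.update x j z) =
      (walkMatrix w ℓ x).updateCol j fun i => reflectedSeries w z (ℓ - (i : ℕ)) := by
  ext1 i k
  rcases eq_or_ne k j with rfl | h
  · simp [walkMatrix]
  · rw [Matrix.updateCol_ne h]
    simp [walkMatrix, Function.update_of_ne (fun h' => h (Fin.ext h') : (k : ℕ) ≠ j)]

theorem walkSeries_update_zero (w : Bool) {ℓ : ℕ} {x : ℕ → ℤ} {j : ℕ} (hj : j < ℓ) (h : x j = 1) :
    walkSeries w ℓ (Function.update x j 0) = if w then walkSeries w ℓ x else 0 := by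
  have h1 := walkMatrix_update w x ⟨j, hj⟩ 0
  rw [walkSeries, h1]
  simp only [reflectedSeries_zero]
  cases w
  · simp only [Bool.false_eq_true, if_false]
    rw [Matrix.det_eq_zero_of_column_eq_zero ⟨j, hj⟩ (by simp), mul_zero]
  · simp only [if_true]
    rw [← h, ← walkMatrix_update true x ⟨j, hj⟩ (x j), Function.update_eq_self]
    simp [walkSeries]

theorem derivative_walkSeries (w : Bool) (ℓ : ℕ) (x : ℕ → ℤ) :
    PowerSeries.derivative ℚ (walkSeries w ℓ x) = (if w then 0 else walkSeries w ℓ x) +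
      ∑ j ∈ Finset.range ℓ, walkSeries w ℓ (Function.update x j (x j + 1)) +
      ∑ j ∈ Finset.range ℓ, walkSeries w ℓ (Function.update x j (x j - 1)) := by
  have h1 : PowerSeries.derivative ℚ (if w then 1 else PowerSeries.exp ℚ) =
      if w then 0 else PowerSeries.exp ℚ := by
    cases w <;> simp [PowerSeries.derivative_exp]
  have h2 : ∀ j : Fin ℓ, ((walkMatrix w ℓ x).updateCol j fun i =>
      PowerSeries.derivative ℚ (walkMatrix w ℓ x i j)).det =
      (walkMatrix w ℓ (Function.update x j (x j + 1))).det +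
      (walkMatrix w ℓ (Function.update x j (x j - 1))).det := by
    intro j
    rw [walkMatrix_update, walkMatrix_update, ← Matrix.det_updateCol_add]
    congr 2
    funext i
    simp [walkMatrix, derivative_reflectedSeries]
  rw [walkSeries, Derivation.leibniz, Derivation.map_det, h1, Finset.sum_congr rfl fun j _ => h2 j,
    Finset.sum_add_distrib, ← Fin.sum_univ_eq_sum_range (fun j => walkSeries w ℓ
      (Function.update x j (x j + 1))), ← Fin.sum_univ_eq_sum_range (fun j => walkSeries w ℓ
      (Function.update x j (x j - 1)))]
  simp only [walkSeries, ← Finset.mul_sum, smul_eq_mul]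
  cases w
  · simp; ring
  · simp

theorem exists_apply_le (μ : ℕ →₀ ℕ) (j : ℕ) : ∃ k, μ k ≤ j := by
  obtain ⟨k, hk⟩ := Infinite.exists_notMem_finset μ.support
  exact ⟨k, by simp [Finsupp.notMem_support_iff.1 hk]⟩

/-- The length of column `j` of the partition `μ`. -/
noncomputable def colLength (μ : ℕ →₀ ℕ) (j : ℕ) : ℕ := Nat.find (exists_apply_le μ j)

theorem lt_colLength {μ : ℕ →₀ ℕ} (hμ : Antitone μ) {j k : ℕ} : k < colLength μ j ↔ j < μ k := by
  rw [colLength, Nat.lt_find_iff]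
  exact ⟨fun h => not_le.1 (h k le_rfl), fun h m hm => not_le.2 (h.trans_le (hμ hm))⟩

theorem colLength_le {μ : ℕ →₀ ℕ} (hμ : Antitone μ) {j k : ℕ} : colLength μ j ≤ k ↔ μ k ≤ j := by
  rw [← not_lt, lt_colLength hμ, not_lt]

theorem colLength_addCell {μ : ℕ →₀ ℕ} (hμ : Antitone μ) {a : ℕ} (ha : a ∈ addableRows μ) (j : ℕ) :
    colLength (addCell μ a) j = colLength μ j + if j = μ a then 1 else 0 := by
  rw [mem_addableRows_iff hμ] at ha
  refine eq_of_forall_lt_iff fun k => ?_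
  rw [lt_colLength (antitone_addCell hμ ((mem_addableRows_iff hμ).2 ha)), addCell_apply]
  have h := lt_colLength hμ (j := j) (k := k)
  split_ifs with h1 h2 h2
  · subst h1 h2
    have := (colLength_le hμ (j := μ k) (k := k)).2 le_rfl
    have : ¬ colLength μ (μ k) < k := fun hlt =>
      ((ha _ hlt).trans_le ((colLength_le hμ).1 le_rfl)).false
    omega
  · subst h1; omega
  · subst h2
    have h3 : k < a → μ a < μ k := ha k
    have h4 : a ≤ k → μ k ≤ μ a := fun h => hμ h
    have := (colLength_le hμ (j := μ a) (k := a)).2 le_rfl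
    omega
  · exact h.symm

/-- The strictly decreasing coordinates of a partition with at most `ℓ` columns. -/
noncomputable def chamberPoint (ℓ : ℕ) (μ : ℕ →₀ ℕ) (j : ℕ) : ℤ := ℓ - j + colLength μ j

theorem chamberPoint_addCell (ℓ : ℕ) {μ : ℕ →₀ ℕ} (hμ : Antitone μ) {a : ℕ}
    (ha : a ∈ addableRows μ) :
    chamberPoint ℓ (addCell μ a) =
      Function.update (chamberPoint ℓ μ) (μ a) (chamberPoint ℓ μ (μ a) + 1) := by
  funext j
  rw [Function.update_apply, chamberPoint, colLength_addCell hμ ha]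
  split_ifs with h
  · subst h; simp [chamberPoint]; ring
  · simp [chamberPoint]

theorem chamberPoint_removeCell (ℓ : ℕ) {μ : ℕ →₀ ℕ} (hμ : Antitone μ) {k : ℕ}
    (hk : k ∈ removableRows μ) :
    chamberPoint ℓ (removeCell μ k) =
      Function.update (chamberPoint ℓ μ) (μ k - 1) (chamberPoint ℓ μ (μ k - 1) - 1) := by
  have h := chamberPoint_addCell ℓ (antitone_removeCell hμ hk) (mem_addableRows_removeCell hμ hk)
  rw [addCell_removeCell hk, removeCell_apply, if_pos rfl] at h
  rw [h]
  simp

/-- Reindexing of a sum over rows `a` by columns `c a`, when the columns that are missed contribute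
nothing. -/
theorem sum_eq_sum_range_of_injOn {s : Finset ℕ} {c : ℕ → ℕ} {ℓ : ℕ} {G f : ℕ → ℚ}
    (hc : Set.InjOn c s) (hG : ∀ a ∈ s, G a = if c a < ℓ then f (c a) else 0)
    (hf : ∀ j < ℓ, (∀ a ∈ s, c a ≠ j) → f j = 0) :
    ∑ j ∈ Finset.range ℓ, f j = ∑ a ∈ s, G a := by
  rw [Finset.sum_congr rfl hG, ← Finset.sum_filter,
    ← Finset.sum_image (f := f) (hc.mono fun a ha => (Finset.mem_filter.1 ha).1)]
  refine (Finset.sum_subset (fun j hj => ?_) fun j hj hj' => hf j (Finset.mem_range.1 hj)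
    fun a ha haj => hj' (Finset.mem_image.2 ⟨a, Finset.mem_filter.2 ⟨ha, ?_⟩, haj⟩)).symm
  · obtain ⟨a, ha, rfl⟩ := Finset.mem_image.1 hj
    exact Finset.mem_range.2 (Finset.mem_filter.1 ha).2
  · rw [haj]; exact Finset.mem_range.1 hj

theorem factorial_mul_coeff_succ (n : ℕ) (f : PowerSeries ℚ) :
    ((n + 1)! : ℚ) * PowerSeries.coeff (n + 1) f =
      (n ! : ℚ) * PowerSeries.coeff n (PowerSeries.derivative ℚ f) := by
  rw [PowerSeries.coeff_derivative, Nat.factorial_succ]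
  push_cast
  ring

theorem coeff_zero_walkSeries (w : Bool) {ℓ : ℕ} {μ : ℕ →₀ ℕ} (hμ : Antitone μ) (h : μ 0 ≤ ℓ) :
    PowerSeries.coeff 0 (walkSeries w ℓ (chamberPoint ℓ μ)) = if μ = 0 then 1 else 0 := by
  have hcoeff : ∀ i j : Fin ℓ, PowerSeries.constantCoeff (walkMatrix w ℓ (chamberPoint ℓ μ) i j) =
      if chamberPoint ℓ μ j = ℓ - (i : ℕ) then 1 else 0 := by
    intro i j
    rw [← PowerSeries.coeff_zero_eq_constantCoeff_apply]
    exact coeff_zero_reflectedSeries w (by simp [chamberPoint]; omega) (by omega)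
  have hexp : PowerSeries.constantCoeff (if w then 1 else PowerSeries.exp ℚ) = 1 := by
    cases w <;> simp
  rw [PowerSeries.coeff_zero_eq_constantCoeff_apply, walkSeries, map_mul, hexp, one_mul,
    RingHom.map_det]
  split_ifs with h0
  · convert Matrix.det_one (n := Fin ℓ) (R := ℚ)
    ext i j
    rw [RingHom.mapMatrix_apply, Matrix.map_apply, hcoeff, Matrix.one_apply]
    have : colLength μ j = 0 := by
      rw [← Nat.le_zero, colLength_le hμ, h0]
      simp
    simp only [chamberPoint, this, Fin.ext_iff]
    split_ifs <;> first | rfl | omega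
  · have h1 : μ 0 ≠ 0 := fun h1 => h0 (by
      ext i
      have := hμ (Nat.zero_le i)
      simpa [h1] using this)
    refine Matrix.det_eq_zero_of_column_eq_zero ⟨0, by omega⟩ fun i => ?_
    rw [RingHom.mapMatrix_apply, Matrix.map_apply, hcoeff, if_neg]
    have := (lt_colLength hμ (j := 0) (k := 0)).2 (Nat.pos_of_ne_zero h1)
    simp only [chamberPoint]
    omega

/-- Both sides satisfy the same recurrence in `n`. A column to which no cell can be added, or from
which none can be removed, moves a coordinate of `chamberPoint` onto its neighbour, where the
determinant vanishes; the only other boundary is the wall, reached by the last coordinate when the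
last column is empty. -/
theorem tableauWeight_eq_coeff (w : Bool) (ℓ n : ℕ) : ∀ {μ : ℕ →₀ ℕ}, Antitone μ → μ 0 ≤ ℓ →
    (tableauWeight w ℓ n μ : ℚ) =
      (n ! : ℚ) * PowerSeries.coeff n (walkSeries w ℓ (chamberPoint ℓ μ)) := by
  induction n with
  | zero =>
    intro μ hμ h
    rw [tableauWeight_zero, coeff_zero_walkSeries w hμ h]
    split_ifs <;> simp
  | succ n ih =>
    intro μ hμ h
    set x := chamberPoint ℓ μ with hx
    let cf : PowerSeries ℚ → ℚ := fun f => (n ! : ℚ) * PowerSeries.coeff n f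
    have hc_zero : cf 0 = 0 := by simp [cf]
    have hup : ∑ j ∈ Finset.range ℓ, cf (walkSeries w ℓ (Function.update x j (x j + 1))) =
        ∑ a ∈ addableRows μ, (tableauWeight w ℓ n (addCell μ a) : ℚ) := by
      refine sum_eq_sum_range_of_injOn (c := μ)
        (f := fun j => cf (walkSeries w ℓ (Function.update x j (x j + 1)))) ?_ ?_ ?_
      · intro a ha b hb hab
        rw [Finset.mem_coe, mem_addableRows_iff hμ] at ha hb
        rcases lt_trichotomy a b with h | h | h
        · exact absurd (hb a h) (by rw [hab]; exact lt_irrefl _)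
        · exact h
        · exact absurd (ha b h) (by rw [hab]; exact lt_irrefl _)
      · intro a ha
        have ha' := (mem_addableRows_iff hμ).1 ha
        split_ifs with hal
        · rw [ih (antitone_addCell hμ ha), chamberPoint_addCell ℓ hμ ha]
          rw [addCell_apply]
          split_ifs with h0
          · rw [h0]; omega
          · omega
        -- a cell beyond column `ℓ` can only be added to the first row, where it is forbidden
        · have h0 : a = 0 := by
            by_contra h0
            have := ha' 0 (Nat.pos_of_ne_zero h0)
            omega
          subst h0
          rw [tableauWeight_eq_zero, Nat.cast_zero]
          rw [addCell_apply, if_pos rfl]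
          omega
      · intro j hj hne
        -- no cell can be added to column `j`, so it is as long as column `j - 1`
        have h1 : j ≠ 0 ∧ colLength μ (j - 1) = colLength μ j := by
          by_contra hcon
          refine hne (colLength μ j) ?_ ?_
          · rw [mem_addableRows_iff hμ]
            intro i hi
            rw [lt_colLength hμ] at hi
            exact ((colLength_le hμ).1 le_rfl).trans_lt hi
          · have h2 : μ (colLength μ j) ≤ j := (colLength_le hμ).1 le_rfl
            by_contra h3
            refine hcon ⟨by omega, le_antisymm ?_ ?_⟩
            · rw [colLength_le hμ]; omega
            · rw [colLength_le hμ]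
              exact ((colLength_le hμ).1 le_rfl).trans (Nat.sub_le _ _)
        change cf _ = 0
        rw [walkSeries_eq_zero_of_eq w (i := j) (j := j - 1) hj (by omega) (by omega), hc_zero]
        rw [Function.update_self, Function.update_of_ne (by omega)]
        simp only [hx, chamberPoint, h1.2]
        omega
    have hdown : ∑ j ∈ Finset.range ℓ, cf (walkSeries w ℓ (Function.update x j (x j - 1))) =
        (if w = true ∧ μ 0 < ℓ then cf (walkSeries w ℓ x) else 0) +
        ∑ k ∈ removableRows μ, (tableauWeight w ℓ n (removeCell μ k) : ℚ) := by
      -- the last coordinate is at the wall iff the last column is empty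
      have hwall : μ 0 < ℓ → cf (walkSeries w ℓ (Function.update x (ℓ - 1) (x (ℓ - 1) - 1))) =
          if w = true then cf (walkSeries w ℓ x) else 0 := by
        intro hlt
        have h1 : x (ℓ - 1) = 1 := by
          have : colLength μ (ℓ - 1) = 0 := by
            rw [← Nat.le_zero, colLength_le hμ]; omega
          simp only [hx, chamberPoint, this]
          omega
        rw [h1, sub_self, walkSeries_update_zero w (by omega) h1]
        split_ifs
        · rfl
        · exact hc_zero
      have h1 : ∑ j ∈ Finset.range ℓ, (if j = ℓ - 1 ∧ w = true ∧ μ 0 < ℓ then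
          cf (walkSeries w ℓ x) else 0) =
          if w = true ∧ μ 0 < ℓ then cf (walkSeries w ℓ x) else 0 := by
        by_cases hc : w = true ∧ μ 0 < ℓ
        · simp [hc, show 0 < ℓ by omega]
        · simp [hc]
      rw [← h1, ← sub_eq_iff_eq_add', ← Finset.sum_sub_distrib]
      refine sum_eq_sum_range_of_injOn (c := fun k => μ k - 1)
        (f := fun j => cf (walkSeries w ℓ (Function.update x j (x j - 1))) -
          if j = ℓ - 1 ∧ w = true ∧ μ 0 < ℓ then cf (walkSeries w ℓ x) else 0) ?_ ?_ ?_
      · intro a ha b hb hab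
        rw [Finset.mem_coe, mem_removableRows] at ha hb
        simp only at hab
        rcases lt_trichotomy a b with h | h | h
        · have := hμ (show a + 1 ≤ b from h); omega
        · exact h
        · have := hμ (show b + 1 ≤ a from h); omega
      · intro k hk
        have hk' := mem_removableRows.1 hk
        have hk0 := hμ (Nat.zero_le k)
        rw [if_pos (by omega), if_neg (by omega), sub_zero, ih (antitone_removeCell hμ hk),
          chamberPoint_removeCell ℓ hμ hk]
        rw [removeCell_apply]
        omega
      · intro j hj hne
        -- no cell can be removed from column `j`, so column `j + 1` is as long
        have key : colLength μ j ≤ colLength μ (j + 1) := by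
          by_contra hcon
          rw [not_le] at hcon
          have h2 := lt_colLength hμ (j := j) (k := colLength μ j - 1)
          have h3 := colLength_le hμ (j := j) (k := colLength μ j)
          have h4 := colLength_le hμ (j := j + 1) (k := colLength μ j - 1)
          refine hne (colLength μ j - 1) ?_ ?_
          · rw [mem_removableRows, show colLength μ j - 1 + 1 = colLength μ j by omega]
            omega
          · omega
        change cf _ - _ = 0
        by_cases hjl : j = ℓ - 1
        · have hlt : μ 0 < ℓ := by
            by_contra hge
            have h5 := lt_colLength hμ (j := j) (k := 0)
            have h6 := colLength_le hμ (j := j + 1) (k := 0)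
            omega
          rw [hjl, hwall hlt]
          simp [hlt]
        · rw [if_neg (by tauto), sub_zero, walkSeries_eq_zero_of_eq w (i := j) (j := j + 1) hj
            (by omega) (by omega), hc_zero]
          have h7 : colLength μ (j + 1) ≤ colLength μ j := by
            rw [colLength_le hμ]
            exact ((colLength_le hμ).1 le_rfl).trans (Nat.le_succ _)
          rw [Function.update_self, Function.update_of_ne (by omega)]
          simp only [hx, chamberPoint]
          omega
    rw [factorial_mul_coeff_succ, derivative_walkSeries, map_add, map_add, map_sum, map_sum,
      mul_add, mul_add, Finset.mul_sum, Finset.mul_sum]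
    have hup' := hup
    have hdown' := hdown
    simp only [cf] at hup' hdown'
    rw [hup', hdown', tableauWeight_succ w n hμ h]
    push_cast
    have hstay := ih hμ h
    rw [← hx] at hstay
    cases w
    · simp [hstay]
    · simp [hstay]; ring

theorem involutionEGF_eq (w : Bool) (ℓ : ℕ) :
    involutionEGF (if w then 2 * ℓ else 2 * ℓ + 1) = (if w then 1 else PowerSeries.exp ℚ) *
      (Matrix.of fun i j : Fin ℓ => reflectedSeries w ((i : ℤ) + 1) ((j : ℤ) + 1)).det := by
  have hmat : walkMatrix w ℓ (chamberPoint ℓ 0) = ((Matrix.of fun i j : Fin ℓ =>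
      reflectedSeries w ((i : ℤ) + 1) ((j : ℤ) + 1)).transpose).submatrix
        Fin.revPerm Fin.revPerm := by
    ext1 i j
    have : colLength 0 j = 0 := by
      rw [← Nat.le_zero, colLength_le (fun _ _ _ => le_rfl)]
      simp
    simp only [walkMatrix, chamberPoint, this, Matrix.of_apply, Matrix.submatrix_apply,
      Matrix.transpose_apply, Fin.revPerm_apply, Fin.val_rev]
    congr 1 <;> omega
  rw [← Matrix.det_transpose, ← Matrix.det_submatrix_equiv_self Fin.revPerm, ← hmat]
  ext n
  have := tableauWeight_eq_coeff w ℓ n (μ := 0) (fun _ _ _ => le_rfl) (by simp)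
  have hn : (n ! : ℚ) ≠ 0 := by exact_mod_cast Nat.factorial_ne_zero n
  rw [involutionEGF, PowerSeries.coeff_mk, ncard_avoidingInvolutions, this,
    mul_div_cancel_left₀ _ hn, walkSeries]

theorem theorem2 (m ℓ : ℕ) :
    (m = 2 * ℓ + 1 →
      involutionEGF m =
        PowerSeries.exp ℚ *
          (Matrix.of fun i j : Fin ℓ =>
            besselSeries (((i : ℤ) + 1) - ((j : ℤ) + 1)) -
              besselSeries (((i : ℤ) + 1) + ((j : ℤ) + 1))).det) ∧
    (m = 2 * ℓ →
      involutionEGF m =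
        (Matrix.of fun i j : Fin ℓ =>
          besselSeries (((i : ℤ) + 1) - ((j : ℤ) + 1)) +
            besselSeries (((i : ℤ) + 1) + ((j : ℤ) + 1) - 1)).det) := by
  refine ⟨?_, ?_⟩
  · rintro rfl
    simpa [reflectedSeries] using involutionEGF_eq false ℓ
  · rintro rfl
    simpa [reflectedSeries] using involutionEGF_eq true ℓ
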